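/- A pin is a point of $\mathbb Z^2$. A pin $p$ separates a set $P$ of pins from a set $Q$ if the vertical or the horizontal line through $p$ has $P$ strictly on one side and $Q$ strictly on the other; $p$ is independent from $S$ if it does not separate $S$ into two non-empty sets. A pin sequence is a finite sequence of pins, no two in the same row or column, in which every pin $p_i$ after the first lies outside the bounding box of the earlier ones and either separates $p_{i-1}$ from the pins before $p_{i-1}$ or is independent from the set of all earlier pins. A pin representation of a permutation $\sigma$ of size $n$ is a pin sequence $(p_1,\dots,p_n)$ that is order isomorphic to the diagram of $\sigma$. A pin word encoding $\sigma$ is a word $w_1\cdots w_n$ over $\{1,2,3,4,U,D,L,R\}$ for which there are a pin representation $(p_1,\dots,p_n)$ of $\sigma$ and an origin $p_0$ such that $(p_0,p_1,\dots,p_n)$ is a pin sequence and, for each $i$: if $w_i\in\{U,D,L,R\}$, then $i\ge 2$ and $p_i$ separates $p_{i-1}$ from $\{p_0,\dots,p_{i-2}\}$, lying respectively above, below, left of or right of all the earlier pins (with the vertical line separating for $U,D$, the horizontal one for $L,R$); if $w_i\in\{1,2,3,4\}$, then $p_i$ is independent from $\{p_0,\dots,p_{i-1}\}$ and lies respectively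 in the up-right, up-left, bottom-left, bottom-right corner of their bounding box. A pin word of length at least $2$ is strict (resp. quasi-strict) if it consists of one numeral (resp. two numerals) followed only by directions $U,D,L,R$. Let $M$ be the set of words of length at least $3$ over $\{L,R,U,D\}$ in which $L,R$ are always followed by $U$ or $D$, and $U,D$ by $L$ or $R$. For a strict pin word $u=u'u''$ with $|u'|=2$ put $\phi(u)=\varphi(u')u''\in M$, where \[ \begin{array}{llll} 1R\mapsto RUR & 2R\mapsto LUR & 3R\mapsto LDR & 4R\mapsto RDR\\ 1L\mapsto RUL & 2L\mapsto LUL & 3L\mapsto LDL & 4L\mapsto RDL\\ 1U\mapsto URU & 2U\mapsto ULU & 3U\mapsto DLU & 4U\mapsto DRU\\ 1D\mapsto URD & 2D\mapsto ULD & 3D\mapsto DLD & 4D\mapsto DRD \end{array} \] and let $\phi$ take on words of length one the two values $\phi(1)\in\{UR,RU\}$, $\phi(2)\in\{UL,LU\}$, $\phi(3)\in\{DL,LD\}$, $\phi(4)\in\{RD,DR\}$. For a permutation $\pi$ of size $k$, let $E(\pi)$ be the set of all words $\phi(u)$ with $u$ a strict pin word encoding $\pi$, together with all words $v\in M$ of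 the form $v=x\,\phi(u_2\cdots u_k)$ with $u=u_1\cdots u_k$ a quasi-strict pin word encoding $\pi$ and $x\in\{LU,LD,RU,RD,UL,UR,DL,DR\}$ (with either value of $\phi$ if $k=2$). A permutation is simple if the only intervals of positions that it maps onto intervals of values are the single positions and the set of all positions. **Theorem.** Let $\pi$ be a simple permutation of size at least $2$ and let $w$ be a strict pin word encoding a permutation $\sigma$. Then $E(\pi)$ is finite with at most $256$ words, and $\pi$ is not a pattern of $\sigma$ if and only if no word of $E(\pi)$ is a factor (a block of consecutive letters) of $\phi(w)$. -/

import Mathlib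

namespace PinPerm

/-! ### Permutations: diagrams, patterns, simple permutations -/

/-- `π` is a pattern of `σ`: some subsequence of the word of `σ` is order isomorphic to `π`. -/
def IsPattern {k n : ℕ} (π : Equiv.Perm (Fin k)) (σ : Equiv.Perm (Fin n)) : Prop :=
  ∃ f : Fin k → Fin n, StrictMono f ∧ ∀ i j, π i < π j ↔ σ (f i) < σ (f j)

/-- `σ` is simple: an interval of positions that is mapped onto an interval of values is either
a single position or consists of all positions. -/
def IsSimple {n : ℕ} (σ : Equiv.Perm (Fin n)) : Prop :=
  ∀ a b c d : Fin n, a ≤ b → σ '' Set.Icc a b = Set.Icc c d → a = b ∨ Set.Icc a b = Set.univ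

/-! ### Pins and pin sequences -/

/-- A pin: a point of the plane at integer coordinates. -/
abbrev Pin := ℤ × ℤ

/-- The bounding box of a set of pins (empty for the empty set). -/
def boundingBox (S : Set Pin) : Set Pin :=
  {q | (∃ a ∈ S, a.1 ≤ q.1) ∧ (∃ a ∈ S, q.1 ≤ a.1) ∧ (∃ a ∈ S, a.2 ≤ q.2) ∧ ∃ a ∈ S, q.2 ≤ a.2}

/-- The vertical line through `p` has `P` on one side and `Q` on the other side. -/
def SeparatesVert (p : Pin) (P Q : Set Pin) : Prop :=
  ((∀ a ∈ P, a.1 < p.1) ∧ ∀ b ∈ Q, p.1 < b.1) ∨ ((∀ a ∈ P, p.1 < a.1) ∧ ∀ b ∈ Q, b.1 < p.1)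

/-- The horizontal line through `p` has `P` on one side and `Q` on the other side. -/
def SeparatesHoriz (p : Pin) (P Q : Set Pin) : Prop :=
  ((∀ a ∈ P, a.2 < p.2) ∧ ∀ b ∈ Q, p.2 < b.2) ∨ ((∀ a ∈ P, p.2 < a.2) ∧ ∀ b ∈ Q, b.2 < p.2)

/-- The pin `p` separates `P` from `Q`. -/
def Separates (p : Pin) (P Q : Set Pin) : Prop :=
  SeparatesVert p P Q ∨ SeparatesHoriz p P Q

/-- The pin `p` is independent from `S`: it does not separate `S` into two non-empty sets. -/
def Independent (p : Pin) (S : Set Pin) : Prop :=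
  ¬ ∃ P Q : Set Pin, P.Nonempty ∧ Q.Nonempty ∧ P ∪ Q = S ∧ Separates p P Q

/-- The pins of the sequence `p` that come before position `i`. -/
def before {m : ℕ} (p : Fin m → Pin) (i : Fin m) : Set Pin :=
  p '' Set.Iio i

/-- `p` is a pin sequence: no two pins in the same column or row, and every pin `p i` but the first
one is outside the bounding box of the earlier ones and either separates its immediate predecessor
`p j` from the pins before `p j`, or is independent from all earlier pins. -/
def IsPinSequence {m : ℕ} (p : Fin m → Pin) : Prop :=
  (∀ i j, i ≠ j → (p i).1 ≠ (p j).1 ∧ (p i).2 ≠ (p j).2) ∧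
  ∀ j i : Fin m, (j : ℕ) + 1 = i →
    p i ∉ boundingBox (before p i) ∧
      (Separates (p i) {p j} (before p j) ∨ Independent (p i) (before p i))

/-- The pins `p` are order isomorphic to the diagram `{(t, σ t)}` of `σ`; the point of the diagram
that corresponds to the pin `p i` is the one in column `τ i`. -/
def Represents {n : ℕ} (p : Fin n → Pin) (σ : Equiv.Perm (Fin n)) : Prop :=
  ∃ τ : Equiv.Perm (Fin n), ∀ i j,
    ((p i).1 < (p j).1 ↔ τ i < τ j) ∧ ((p i).2 < (p j).2 ↔ σ (τ i) < σ (τ j))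

/-- `p` is a pin representation of `σ`. -/
def IsPinRepresentation {n : ℕ} (p : Fin n → Pin) (σ : Equiv.Perm (Fin n)) : Prop :=
  IsPinSequence p ∧ Represents p σ

/-! ### Pin words -/

/-- The directions: left, right, up, down. -/
inductive Direction
  | L | R | U | D
  deriving DecidableEq

/-- The numerals 1, 2, 3, 4, i.e. the up-right, up-left, bottom-left, bottom-right quadrants. -/
inductive Numeral
  | one | two | three | four
  deriving DecidableEq

/-- The alphabet `{1, 2, 3, 4, U, D, L, R}` of pin words. -/
inductive Letter
  | num (q : Numeral)
  | dir (d : Direction)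
  deriving DecidableEq

/-- `p` lies beyond all of `S` in direction `d`. -/
def Beyond (p : Pin) (S : Set Pin) : Direction → Prop
  | .L => ∀ a ∈ S, p.1 < a.1
  | .R => ∀ a ∈ S, a.1 < p.1
  | .U => ∀ a ∈ S, a.2 < p.2
  | .D => ∀ a ∈ S, p.2 < a.2

/-- `p` separates `P` from `Q` from the side `d`. -/
def SeparatesFrom (p : Pin) (P Q : Set Pin) (d : Direction) : Prop :=
  Beyond p (P ∪ Q) d ∧
    match d with
    | .U | .D => SeparatesVert p P Q
    | .L | .R => SeparatesHoriz p P Q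

/-- `p` is situated in the corner `q` of the bounding box of `S`. -/
def InQuadrant (p : Pin) (S : Set Pin) : Numeral → Prop
  | .one => Beyond p S .R ∧ Beyond p S .U
  | .two => Beyond p S .L ∧ Beyond p S .U
  | .three => Beyond p S .L ∧ Beyond p S .D
  | .four => Beyond p S .R ∧ Beyond p S .D

/-- In the sequence `p` (whose first entry is the origin), the pin `p i`, with immediate
predecessor `p j`, is encoded by the given letter. A direction requires that there are pins
before `p j`. -/
def EncodedBy {m : ℕ} (p : Fin m → Pin) (j i : Fin m) : Letter → Prop
  | .dir d => (before p j).Nonempty ∧ SeparatesFrom (p i) {p j} (before p j) d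
  | .num q => Independent (p i) (before p i) ∧ InQuadrant (p i) (before p i) q

/-- The word `w` is a pin word encoding `σ` (corresponding to `σ`): there are an origin `p 0` and a
pin representation `(p 1, …, p n)` of `σ` such that `(p 0, p 1, …, p n)` is a pin sequence and the
`i`-th letter of `w` encodes the pin `p i` for `i = 1, …, n`. -/
def Encodes {n : ℕ} (w : List Letter) (σ : Equiv.Perm (Fin n)) : Prop :=
  ∃ p : Fin (n + 1) → Pin, IsPinRepresentation (fun i : Fin n => p i.succ) σ ∧ IsPinSequence p ∧
    ∃ a : Fin n → Letter, w = List.ofFn a ∧ ∀ i : Fin n, EncodedBy p i.castSucc i.succ (a i)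

/-- The shape of a strict pin word: length at least 2, a numeral followed only by directions. -/
def IsStrict (w : List Letter) : Prop :=
  2 ≤ w.length ∧ ∃ (q : Numeral) (ds : List Direction), w = .num q :: ds.map .dir

/-- The shape of a quasi-strict pin word: two numerals followed only by directions. -/
def IsQuasiStrict (w : List Letter) : Prop :=
  ∃ (q r : Numeral) (ds : List Direction), w = .num q :: .num r :: ds.map .dir

/-! ### The map `φ` and the set of factors `E(π)` -/

/-- The 8 pairs consisting of a horizontal and a vertical direction, in either order, viewed as a
relation: `d` may be followed by `e`. -/
def Alternates : Direction → Direction → Prop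
  | .L, .U | .L, .D | .R, .U | .R, .D => True
  | .U, .L | .U, .R | .D, .L | .D, .R => True
  | _, _ => False

/-- The set `M` of words of length at least 3 over `{L, R, U, D}` in which `L`, `R` are followed
by `U`, `D` and conversely. -/
def M : Set (List Direction) :=
  {v | 3 ≤ v.length ∧ v.IsChain Alternates}

open Direction Numeral in
/-- The table of the values of `φ` on the words of length 2 (a numeral, then a direction). -/
def varphi : Numeral → Direction → List Direction
  | one, R => [R, U, R]
  | two, R => [L, U, R]
  | three, R => [L, D, R]
  | four, R => [R, D, R]
  | one, L => [R, U, L]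
  | two, L => [L, U, L]
  | three, L => [L, D, L]
  | four, L => [R, D, L]
  | one, U => [U, R, U]
  | two, U => [U, L, U]
  | three, U => [D, L, U]
  | four, U => [D, R, U]
  | one, D => [U, R, D]
  | two, D => [U, L, D]
  | three, D => [D, L, D]
  | four, D => [D, R, D]

/-- The direction that a letter is, if it is one. -/
def Letter.toDirection? : Letter → Option Direction
  | .dir d => some d
  | .num _ => none

/-- `φ` on strict pin words `q d u''`: replace the prefix `q d` by `varphi q d`.
It is only meant for words of the strict shape. -/
def phi : List Letter → List Direction
  | .num q :: .dir d :: rest => varphi q d ++ rest.filterMap Letter.toDirection?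
  | _ => []

open Direction Numeral in
/-- The set of the two values of `φ` on a word of length 1 that is a numeral. -/
def phiNumeral : Numeral → Set (List Direction)
  | one => {[U, R], [R, U]}
  | two => {[U, L], [L, U]}
  | three => {[D, L], [L, D]}
  | four => {[R, D], [D, R]}

/-- The set of values of the extended map `φ`: two values on a single numeral, one value on a
strict pin word. -/
def phiValues : List Letter → Set (List Direction)
  | [.num q] => phiNumeral q
  | u => {phi u}

/-- The set `E(π)`: the words `φ(u)` for `u` a strict pin word of `π`, and the words
`x φ(u₂ … uₙ)` of `M` for `u` a quasi-strict pin word of `π` and `x` one of the 8 words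
`LU, LD, RU, RD, UL, UR, DL, DR`. -/
def E {k : ℕ} (π : Equiv.Perm (Fin k)) : Set (List Direction) :=
  {v | ∃ u, IsStrict u ∧ Encodes u π ∧ v = phi u} ∪
  {v | v ∈ M ∧ ∃ u, IsQuasiStrict u ∧ Encodes u π ∧
    ∃ x₁ x₂ : Direction, Alternates x₁ x₂ ∧ ∃ y ∈ phiValues u.tail, v = x₁ :: x₂ :: y}

end PinPerm

namespace PinPerm

/-! Write `m` for the word `φ(w)`: it has one letter for the origin `p 0` and one for each pin. The
pin `p (i + 1)` lies beyond all earlier pins in direction `m (i + 1)`; in direction `m i` it lies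
beyond everything before `p i`, but for `i > 0` not beyond `p i` itself (`Along`). So `m` alone
fixes the order type of the sequence (`Along.key_lt_iff`), and a factor of `m` fixes that of the
corresponding block of consecutive pins together with one earlier pin not adjacent to the block
(`Along.segment`). Hence a factor from `E π` produces an occurrence of `π`.

Conversely, list an occurrence of `π` in pin order. If a pin is skipped, every later chosen pin lies
in a corner of the chosen pins before the gap, so the latter form an interval, and by simplicity
there is only one of them (`IsSimple.eq_zero_of_forall_beyond`). The occurrence is therefore one pin
followed by a block of consecutive pins. If they are adjacent, reading them from the origin gives a
strict word; otherwise a quasi-strict one, the single pin acting as origin of the block. The two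
letters `x` ensure that such a pin exists other than `p 0`, which is not a point of `σ`.

For the bound, peel off pins from the end: the last letter determines all letters belonging to the
third and later pins of `π` (`AlongFromThird.eq_of_last_eq`). With the free initial letters this
leaves at most 64 + 128 words. -/

instance : Fintype Direction := ⟨{.L, .R, .U, .D}, by intro x; cases x <;> decide⟩

instance : DecidableRel Alternates := fun a b => by
  cases a <;> cases b <;> unfold Alternates <;> infer_instance

/-! ### Directions as coordinates; separation and quadrants -/

/-- The coordinate of a pin that increases in the given direction. -/
def Direction.key : Direction → Pin → ℤ
  | .L, p => -p.1
  | .R, p => p.1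
  | .U, p => p.2
  | .D, p => -p.2

/-- The quadrant spanned by two perpendicular directions. -/
def quadrant : Direction → Direction → Numeral
  | .U, .R | .R, .U => .one
  | .U, .L | .L, .U => .two
  | .D, .L | .L, .D => .three
  | _, _ => .four

theorem beyond_iff {p : Pin} {S : Set Pin} {d : Direction} :
    Beyond p S d ↔ ∀ a ∈ S, d.key a < d.key p := by
  cases d <;> simp [Beyond, Direction.key]

/-- The two ways of lying on opposite sides of the line become a choice of the direction `e` in
which `P` lies, so that later arguments need no case split over axes. -/
theorem separatesFrom_iff {p : Pin} {P Q : Set Pin} {d : Direction} :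
    SeparatesFrom p P Q d ↔ (∀ a ∈ P ∪ Q, d.key a < d.key p) ∧
      ∃ e, Alternates e d ∧ (∀ a ∈ P, e.key p < e.key a) ∧ ∀ b ∈ Q, e.key b < e.key p := by
  unfold SeparatesFrom
  rw [beyond_iff]
  refine and_congr_right fun _ => ?_
  cases d <;> constructor
  all_goals
    first
    | rintro (⟨h₁, h₂⟩ | ⟨h₁, h₂⟩)
      · first
        | exact ⟨.L, by decide, fun a ha => neg_lt_neg (h₁ a ha), fun a ha => neg_lt_neg (h₂ a ha)⟩
        | exact ⟨.D, by decide, fun a ha => neg_lt_neg (h₁ a ha), fun a ha => neg_lt_neg (h₂ a ha)⟩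
      · first
        | exact ⟨.R, by decide, h₁, h₂⟩
        | exact ⟨.U, by decide, h₁, h₂⟩
    | rintro ⟨e, he, h₁, h₂⟩
      cases e <;> first
        | exact absurd he (by decide)
        | exact Or.inr ⟨h₁, h₂⟩
        | exact Or.inl ⟨fun a ha => neg_lt_neg_iff.1 (h₁ a ha), fun a ha => neg_lt_neg_iff.1 (h₂ a ha)⟩

theorem inQuadrant_quadrant_iff {p : Pin} {S : Set Pin} {e d : Direction} (h : Alternates e d) :
    InQuadrant p S (quadrant e d) ↔
      (∀ a ∈ S, e.key a < e.key p) ∧ ∀ a ∈ S, d.key a < d.key p := by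
  simp only [← beyond_iff]
  cases e <;> cases d <;>
    first
    | exact absurd h (by decide)
    | exact Iff.rfl
    | exact and_comm

theorem InQuadrant.independent {p : Pin} {S : Set Pin} {q : Numeral} (h : InQuadrant p S q) :
    Independent p S := by
  rintro ⟨P, Q, ⟨a, ha⟩, ⟨b, hb⟩, rfl, hs⟩
  have hv : ∀ {x}, InQuadrant p (P ∪ Q) x → (a.1 < p.1 ∧ b.1 < p.1 ∨ p.1 < a.1 ∧ p.1 < b.1) ∧
      (a.2 < p.2 ∧ b.2 < p.2 ∨ p.2 < a.2 ∧ p.2 < b.2) := by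
    intro x hx
    have ha' : a ∈ P ∪ Q := Or.inl ha
    have hb' : b ∈ P ∪ Q := Or.inr hb
    cases x <;> have h1 := hx.1 a ha' <;> have h2 := hx.1 b hb' <;> have h3 := hx.2 a ha' <;>
      have h4 := hx.2 b hb' <;> simp only [h1, h2, h3, h4, and_true, true_or, or_true]
  have := hv h
  rcases hs with (⟨h₁, h₂⟩ | ⟨h₁, h₂⟩) | (⟨h₁, h₂⟩ | ⟨h₁, h₂⟩) <;>
    have h₁ := h₁ a ha <;> have h₂ := h₂ b hb <;> omega

theorem InQuadrant.exists_beyond {p : Pin} {S : Set Pin} {q : Numeral} (h : InQuadrant p S q) :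
    ∃ d, Beyond p S d := by
  cases q
  exacts [⟨_, h.1⟩, ⟨_, h.1⟩, ⟨_, h.1⟩, ⟨_, h.1⟩]

theorem Beyond.notMem_boundingBox {p : Pin} {S : Set Pin} {d : Direction} (h : Beyond p S d) :
    p ∉ boundingBox S := by
  rintro ⟨⟨a, ha, ha'⟩, ⟨b, hb, hb'⟩, ⟨c, hc, hc'⟩, ⟨e, he, he'⟩⟩
  cases d
  · exact absurd (h a ha) (by omega)
  · exact absurd (h b hb) (by omega)
  · exact absurd (h e he) (by omega)
  · exact absurd (h c hc) (by omega)

theorem SeparatesFrom.separates {p : Pin} {P Q : Set Pin} {d : Direction}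
    (h : SeparatesFrom p P Q d) : Separates p P Q := by
  cases d
  exacts [Or.inr h.2, Or.inr h.2, Or.inl h.2, Or.inl h.2]

theorem Separates.mono {p : Pin} {P P' Q Q' : Set Pin} (h : Separates p P Q) (hP : P' ⊆ P)
    (hQ : Q' ⊆ Q) : Separates p P' Q' := by
  rcases h with (⟨h₁, h₂⟩ | ⟨h₁, h₂⟩) | (⟨h₁, h₂⟩ | ⟨h₁, h₂⟩)
  · exact Or.inl (Or.inl ⟨fun a ha => h₁ a (hP ha), fun a ha => h₂ a (hQ ha)⟩)
  · exact Or.inl (Or.inr ⟨fun a ha => h₁ a (hP ha), fun a ha => h₂ a (hQ ha)⟩)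
  · exact Or.inr (Or.inl ⟨fun a ha => h₁ a (hP ha), fun a ha => h₂ a (hQ ha)⟩)
  · exact Or.inr (Or.inr ⟨fun a ha => h₁ a (hP ha), fun a ha => h₂ a (hQ ha)⟩)

theorem Separates.insert_or {p a : Pin} {P Q : Set Pin} (h : Separates p P Q) (h₁ : a.1 ≠ p.1)
    (h₂ : a.2 ≠ p.2) : Separates p (insert a P) Q ∨ Separates p P (insert a Q) := by
  simp only [Separates, SeparatesVert, SeparatesHoriz, Set.forall_mem_insert] at h ⊢
  rcases h with (⟨hP, hQ⟩ | ⟨hP, hQ⟩) | (⟨hP, hQ⟩ | ⟨hP, hQ⟩)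
  · exact (lt_or_gt_of_ne h₁).imp (fun h => Or.inl (Or.inl ⟨⟨h, hP⟩, hQ⟩))
      fun h => Or.inl (Or.inl ⟨hP, h, hQ⟩)
  · exact (lt_or_gt_of_ne h₁).symm.imp (fun h => Or.inl (Or.inr ⟨⟨h, hP⟩, hQ⟩))
      fun h => Or.inl (Or.inr ⟨hP, h, hQ⟩)
  · exact (lt_or_gt_of_ne h₂).imp (fun h => Or.inr (Or.inl ⟨⟨h, hP⟩, hQ⟩))
      fun h => Or.inr (Or.inl ⟨hP, h, hQ⟩)
  · exact (lt_or_gt_of_ne h₂).symm.imp (fun h => Or.inr (Or.inr ⟨⟨h, hP⟩, hQ⟩))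
      fun h => Or.inr (Or.inr ⟨hP, h, hQ⟩)

/-! ### Pin sequences indexed by natural numbers -/

/-- The position of the `i`-th successor of the origin `p 0` is described by the given letter. -/
def EncodedAt (p : ℕ → Pin) (i : ℕ) : Letter → Prop
  | .dir d => 0 < i ∧ SeparatesFrom (p (i + 1)) {p i} (p '' Set.Iio i) d
  | .num q => InQuadrant (p (i + 1)) (p '' Set.Iio (i + 1)) q

theorem before_comp_val {m : ℕ} (p : ℕ → Pin) (i : Fin m) :
    before (fun j : Fin m => p j) i = p '' Set.Iio (i : ℕ) := by
  ext x
  constructor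
  · rintro ⟨j, hj, rfl⟩
    exact ⟨j, hj, rfl⟩
  · rintro ⟨j, hj, rfl⟩
    exact ⟨⟨j, lt_trans hj i.2⟩, hj, rfl⟩

theorem exists_comp_val {m : ℕ} (p : Fin m → Pin) : ∃ P : ℕ → Pin, p = fun i : Fin m => P i :=
  ⟨fun i => if h : i < m then p ⟨i, h⟩ else 0, by ext i : 1; simp⟩

theorem encodedBy_comp_val {n : ℕ} (p : ℕ → Pin) (i : Fin n) (a : Letter) :
    EncodedBy (fun j : Fin (n + 1) => p j) i.castSucc i.succ a ↔ EncodedAt p i a := by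
  cases a with
  | num q =>
    simp only [EncodedBy, EncodedAt, before_comp_val, Fin.val_succ]
    exact ⟨fun h => h.2, fun h => ⟨h.independent, h⟩⟩
  | dir d =>
    simp only [EncodedBy, EncodedAt, before_comp_val, Fin.val_succ, Fin.val_castSucc,
      Set.image_nonempty]
    refine and_congr_left fun _ => ?_
    constructor
    · rintro ⟨j, hj⟩
      exact lt_of_le_of_lt (Nat.zero_le j) hj
    · exact fun h => ⟨0, h⟩

theorem Encodes.exists_nat {n : ℕ} {w : List Letter} {σ : Equiv.Perm (Fin n)} (h : Encodes w σ) :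
    w.length = n ∧ ∃ p : ℕ → Pin, Represents (fun i : Fin n => p (i + 1)) σ ∧
      ∀ i (hi : i < w.length), EncodedAt p i w[i] := by
  obtain ⟨p, ⟨-, hr⟩, -, a, rfl, ha⟩ := h
  obtain ⟨P, rfl⟩ := exists_comp_val p
  refine ⟨by simp, P, by simpa using hr, fun i hi => ?_⟩
  have := (encodedBy_comp_val P ⟨i, by simpa using hi⟩ _).1 (ha ⟨i, by simpa using hi⟩)
  simpa using this

/-- Independence survives the loss of the origin: a line through a later pin that splits the
remaining pins has the origin strictly on one side, so it would also split the full set. -/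
theorem IsPinSequence.tail {n : ℕ} {p : ℕ → Pin}
    (h : IsPinSequence (fun i : Fin (n + 1) => p i)) :
    IsPinSequence (fun i : Fin n => p (i + 1)) := by
  obtain ⟨hd, hs⟩ := h
  refine ⟨fun i j hij => by simpa using hd i.succ j.succ (by simpa using hij), fun j i hji => ?_⟩
  have hsub : ∀ l : Fin n, before (fun i : Fin n => p (i + 1)) l ⊆
      before (fun i : Fin (n + 1) => p i) l.succ := by
    rintro l _ ⟨t, ht, rfl⟩
    exact ⟨t.succ, by simpa using ht, by simp⟩
  obtain ⟨hb, hc⟩ := hs j.succ i.succ (by simpa using hji)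
  refine ⟨?_, ?_⟩
  · rintro ⟨⟨a, ha, ha'⟩, ⟨b, hb₁, hb'⟩, ⟨c, hc, hc'⟩, ⟨e, he, he'⟩⟩
    exact hb ⟨⟨a, hsub i ha, by simpa using ha'⟩, ⟨b, hsub i hb₁, by simpa using hb'⟩,
      ⟨c, hsub i hc, by simpa using hc'⟩, ⟨e, hsub i he, by simpa using he'⟩⟩
  · refine hc.imp (fun h => ?_) fun h => ?_
    · simp only [Fin.val_succ] at h
      exact h.mono subset_rfl (hsub j)
    · rintro ⟨P, Q, hP, hQ, hPQ, hsep⟩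
      have hset : before (fun i : Fin (n + 1) => p i) i.succ =
          insert (p 0) (before (fun i : Fin n => p (i + 1)) i) := by
        ext x
        constructor
        · rintro ⟨t, ht, rfl⟩
          induction t using Fin.cases with
          | zero => exact Or.inl (by simp)
          | succ t => exact Or.inr ⟨t, by simpa using ht, by simp⟩
        · rintro (rfl | hx)
          · exact ⟨0, by simp, by simp⟩
          · exact hsub i hx
      have hne := hd 0 i.succ (by simp [Fin.ext_iff])
      simp only [Fin.val_zero, Fin.val_succ] at hne h
      have h0 := hsep.insert_or (a := p 0) hne.1 hne.2
      rcases h0 with h0 | h0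
      · exact h ⟨_, _, Set.insert_nonempty _ _, hQ, by rw [hset, Set.insert_union, hPQ], h0⟩
      · exact h ⟨_, _, hP, Set.insert_nonempty _ _, by rw [hset, Set.union_insert, hPQ], h0⟩

/-- Each letter already forces its pin outside the bounding box and makes it separating or
independent; of the pin sequence axioms only distinctness of coordinates has to be supplied. -/
theorem encodes_of_encodedAt {n : ℕ} {σ : Equiv.Perm (Fin n)} {p : ℕ → Pin} (a : Fin n → Letter)
    (hr : Represents (fun i : Fin n => p (i + 1)) σ)
    (hd : ∀ i j, i < j → j ≤ n → (p i).1 ≠ (p j).1 ∧ (p i).2 ≠ (p j).2)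
    (ha : ∀ i : Fin n, EncodedAt p i (a i)) : Encodes (List.ofFn a) σ := by
  have hp : IsPinSequence (fun i : Fin (n + 1) => p i) := by
    refine ⟨fun i j hij => ?_, fun j i hji => ?_⟩
    · rcases lt_or_gt_of_ne hij with h | h
      · exact hd i j h (by omega)
      · exact (hd j i h (by omega)).imp Ne.symm Ne.symm
    · have hjn : (j : ℕ) < n := by omega
      have h := ha ⟨j, hjn⟩
      rw [before_comp_val, before_comp_val]
      dsimp only
      rw [← hji]
      generalize a ⟨j, hjn⟩ = l at h
      cases l with
      | num q =>
        obtain ⟨d, hd⟩ := InQuadrant.exists_beyond h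
        exact ⟨hd.notMem_boundingBox, Or.inr (InQuadrant.independent h)⟩
      | dir d =>
        have h : SeparatesFrom (p (j + 1)) {p j} (p '' Set.Iio (j : ℕ)) d := h.2
        refine ⟨?_, Or.inl h.separates⟩
        have := h.1.notMem_boundingBox
        rwa [Set.singleton_union, ← Set.image_insert_eq, Set.Iio_insert,
          show Set.Iic (j : ℕ) = Set.Iio ((j : ℕ) + 1) by ext; simp] at this
  refine ⟨_, ⟨?_, ?_⟩, hp, a, rfl, fun i => (encodedBy_comp_val p i _).2 (ha i)⟩
  · simpa using hp.tail
  · simpa using hr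

/-! ### Pins placed along an alternating word -/

/-- The pins `p 1, …, p N` are placed along the alternating word `m`: the pin `p (i + 1)` lies
beyond all earlier ones in direction `m (i + 1)`, and in direction `m i` it is situated between
`p i` and the pins before `p i`. -/
def Along (m : ℕ → Direction) (p : ℕ → Pin) (N : ℕ) : Prop :=
  ∀ i < N, Alternates (m i) (m (i + 1)) ∧
    (∀ j ≤ i, (m (i + 1)).key (p j) < (m (i + 1)).key (p (i + 1))) ∧
    (∀ j < i, (m i).key (p j) < (m i).key (p (i + 1))) ∧
    (i = 0 → (m 0).key (p 0) < (m 0).key (p 1)) ∧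
    (0 < i → (m i).key (p (i + 1)) < (m i).key (p i))

/-- Every direction agrees with or is opposite to one of two perpendicular directions. -/
theorem Alternates.key_cases {d e : Direction} (h : Alternates e d) (c : Direction) :
    c = e ∨ c = d ∨ (∀ p, c.key p = -e.key p) ∨ ∀ p, c.key p = -d.key p := by
  cases e <;> cases d <;> first | exact absurd h (by decide) | skip
  all_goals cases c <;> simp [Direction.key]

theorem Alternates.eq_or_key_neg {d e c : Direction} (h : Alternates e d) (h' : Alternates c d) :
    c = e ∨ ∀ p, c.key p = -e.key p := by
  cases e <;> cases d <;> first | exact absurd h (by decide) | skip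
  all_goals cases c <;> first | exact absurd h' (by decide) | simp [Direction.key]

theorem not_alternates_trans {a b c : Direction} (h : Alternates a b) (h' : Alternates b c) :
    ¬ Alternates a c := by
  revert h h'; revert a b c; decide

/-- The only direction in which a pin lies beyond all earlier ones. -/
theorem Along.eq_of_beyond {m : ℕ → Direction} {p : ℕ → Pin} {N i : ℕ} (h : Along m p N)
    (hi : i < N) {c : Direction} (hc : ∀ j ≤ i, c.key (p j) < c.key (p (i + 1))) :
    c = m (i + 1) ∨ i = 0 ∧ c = m 0 := by
  obtain ⟨ha, h₁, h₂, h₃, h₄⟩ := h i hi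
  -- The first pin is beyond the origin in both directions `m 0` and `m 1`, which causes the
  -- exceptional alternative.
  rcases Nat.eq_zero_or_pos i with rfl | h0
  · rcases ha.key_cases c with h | h | h | h
    · exact Or.inr ⟨rfl, h⟩
    · exact Or.inl h
    · have := hc 0 le_rfl
      have : (m 0).key (p 0) < (m 0).key (p (0 + 1)) := h₃ rfl
      simp only [h] at *
      omega
    · have := hc 0 le_rfl
      have := h₁ 0 le_rfl
      simp only [h] at *
      omega
  · rcases ha.key_cases c with h | h | h | h
    · have := hc i le_rfl
      have := h₄ h0
      rw [h] at *
      omega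
    · exact Or.inl h
    · have := hc 0 (by omega)
      have := h₂ 0 h0
      simp only [h] at *
      omega
    · have := hc 0 (by omega)
      have := h₁ 0 (by omega)
      simp only [h] at *
      omega

/-- The letter `i` of the word `v`. -/
def letterAt (v : List Direction) (i : ℕ) : Direction := v.getD i .L

/-- Uniform content of the table: the numeral becomes two directions spanning its quadrant, in the
order that lets the next letter alternate. With no next letter both orders remain. -/
theorem exists_of_mem_phiValues {q : Numeral} {ds y : List Direction}
    (hy : y ∈ phiValues (.num q :: ds.map .dir)) :
    ∃ e d, y = e :: d :: ds ∧ Alternates e d ∧ quadrant e d = q ∧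
      ∀ c ∈ ds.head?, Alternates d c := by
  cases ds with
  | nil =>
    cases q <;> rcases hy with rfl | rfl <;> exact ⟨_, _, rfl, by decide, rfl, by simp⟩
  | cons c ds =>
    have : y = varphi q c ++ ds := by
      simpa [phiValues, phi, List.filterMap_map, Function.comp_def, Letter.toDirection?] using hy
    subst this
    cases q <;> cases c <;> exact ⟨_, _, rfl, by decide, rfl, by simp; decide⟩

theorem mem_phiValues {e d : Direction} {ds : List Direction} (h : Alternates e d)
    (hd : ∀ c ∈ ds.head?, Alternates d c) :
    e :: d :: ds ∈ phiValues (.num (quadrant e d) :: ds.map .dir) := by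
  cases ds with
  | nil =>
    cases e <;> cases d <;> first | exact absurd h (by decide) | simp [phiValues, phiNumeral, quadrant]
  | cons c ds =>
    replace hd : Alternates d c := hd c (by simp)
    suffices varphi (quadrant e d) c = [e, d, c] by
      simp [phiValues, phi, List.filterMap_map, Function.comp_def, Letter.toDirection?, this]
    revert h hd
    revert e d c
    decide

/-- The pins encoded by a numeral followed by directions are placed along the image of the word
under `φ`. -/
theorem along_of_encodedAt {q : Numeral} {ds y : List Direction} {p : ℕ → Pin}
    (h0 : InQuadrant (p 1) {p 0} q)
    (hd : ∀ i (hi : i < ds.length),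
      SeparatesFrom (p (i + 2)) {p (i + 1)} (p '' Set.Iio (i + 1)) ds[i])
    (hy : y ∈ phiValues (.num q :: ds.map .dir)) : Along (letterAt y) p (ds.length + 1) := by
  obtain ⟨e, d, rfl, hed, rfl, hds⟩ := exists_of_mem_phiValues hy
  rw [inQuadrant_quadrant_iff hed] at h0
  obtain ⟨h0, h0'⟩ := h0
  simp only [Set.mem_singleton_iff, forall_eq] at h0 h0'
  suffices ∀ N ≤ ds.length + 1, Along (letterAt (e :: d :: ds)) p N from this _ le_rfl
  intro N
  induction N with
  | zero => exact fun _ i hi => absurd hi (by omega)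
  | succ N ih =>
    intro hN i hi
    have ih := ih (by omega)
    rcases Nat.lt_or_ge i N with h | h
    · exact ih i h
    obtain rfl : i = N := by omega
    cases i with
    | zero =>
      refine ⟨hed, fun j hj => ?_, by simp, fun _ => h0, by simp⟩
      obtain rfl : j = 0 := by omega
      exact h0'
    | succ i =>
      have hi' : i < ds.length := by omega
      have hl : letterAt (e :: d :: ds) (i + 2) = ds[i] := by
        simp [letterAt, hi']
      obtain ⟨h₁, c, hc, h₂, h₃⟩ := separatesFrom_iff.1 (hd i hi')
      simp only [Set.mem_singleton_iff, forall_eq, Set.mem_union, Set.forall_mem_image,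
        Set.mem_Iio] at h₁ h₂ h₃
      have h₁' : ∀ j ≤ i + 1, ds[i].key (p j) < ds[i].key (p (i + 2)) := by
        intro j hj
        rcases Nat.lt_or_ge j (i + 1) with h | h
        · exact h₁ _ (Or.inr ⟨j, h, rfl⟩)
        · obtain rfl : j = i + 1 := by omega
          exact h₁ _ (Or.inl rfl)
      -- Since `p (i + 2)` separates, `p (i + 1)` lies beyond all earlier pins in direction `c`,
      -- which leaves only its own letter. For `i = 0` the alternative `c = e` fails: `e` is on the
      -- same axis as the first letter of `ds`.
      have hcm : c = letterAt (e :: d :: ds) (i + 1) := by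
        rcases ih.eq_of_beyond (i := i) (by omega) (c := c)
          (fun j hj => (h₃ (Nat.lt_succ_of_le hj)).trans h₂) with hc' | ⟨rfl, hc'⟩
        · exact hc'
        · obtain rfl : c = e := hc'
          exact absurd hc (not_alternates_trans hed (hds _ (by
            rw [List.head?_eq_getElem?, List.getElem?_eq_getElem hi']; simp)))
      refine ⟨?_, ?_, ?_, by simp, ?_⟩
      · rw [hl, ← hcm]
        exact hc
      · rw [hl]
        exact h₁'
      · rw [← hcm]
        exact fun j hj => h₃ hj
      · rw [← hcm]
        exact fun _ => h₂

/-! ### Order type of the pins and of their segments -/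

/-- Two sequences of pins along the same word are order isomorphic. -/
theorem Along.key_lt_iff {m : ℕ → Direction} {p p' : ℕ → Pin} {N : ℕ} (h : Along m p N)
    (h' : Along m p' N) {i j : ℕ} (hi : i ≤ N) (hj : j ≤ N) (c : Direction) :
    c.key (p i) < c.key (p j) ↔ c.key (p' i) < c.key (p' j) := by
  have main : ∀ i j, i < j → j ≤ N →
      c.key (p i) < c.key (p j) ∧ c.key (p' i) < c.key (p' j) ∨
      c.key (p j) < c.key (p i) ∧ c.key (p' j) < c.key (p' i) := by
    intro i j hij hj
    obtain ⟨j, rfl⟩ : ∃ t, j = t + 1 := ⟨j - 1, by omega⟩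
    obtain ⟨ha, h₁, h₂, h₃, h₄⟩ := h j (by omega)
    obtain ⟨-, h₁', h₂', h₃', h₄'⟩ := h' j (by omega)
    have hd := h₁ i (by omega)
    have hd' := h₁' i (by omega)
    have he : (m j).key (p i) < (m j).key (p (j + 1)) ∧ (m j).key (p' i) < (m j).key (p' (j + 1)) ∨
        (m j).key (p (j + 1)) < (m j).key (p i) ∧ (m j).key (p' (j + 1)) < (m j).key (p' i) := by
      rcases Nat.lt_or_ge i j with hlt | hge
      · exact Or.inl ⟨h₂ i hlt, h₂' i hlt⟩
      · obtain rfl : i = j := by omega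
        rcases Nat.eq_zero_or_pos i with rfl | h0
        · exact Or.inl ⟨h₃ rfl, h₃' rfl⟩
        · exact Or.inr ⟨h₄ h0, h₄' h0⟩
    rcases ha.key_cases c with rfl | rfl | hc | hc
    · exact he
    · exact Or.inl ⟨hd, hd'⟩
    · simp only [hc]
      omega
    · simp only [hc]
      omega
  rcases lt_trichotomy i j with hij | rfl | hij
  · rcases main i j hij hj with h | h <;> omega
  · simp
  · rcases main j i hij hi with h | h <;> omega

theorem Along.key_ne {m : ℕ → Direction} {p : ℕ → Pin} {N : ℕ} (h : Along m p N) {i j : ℕ}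
    (hij : i < j) (hj : j ≤ N) (c : Direction) : c.key (p i) ≠ c.key (p j) := by
  obtain ⟨j, rfl⟩ : ∃ t, j = t + 1 := ⟨j - 1, by omega⟩
  obtain ⟨ha, h₁, h₂, h₃, h₄⟩ := h j (by omega)
  have hd := h₁ i (by omega)
  have he : (m j).key (p i) ≠ (m j).key (p (j + 1)) := by
    rcases Nat.lt_or_ge i j with hlt | hge
    · exact (h₂ i hlt).ne
    · obtain rfl : i = j := by omega
      rcases Nat.eq_zero_or_pos i with rfl | h0
      · exact (h₃ rfl).ne
      · exact (h₄ h0).ne'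
  rcases ha.key_cases c with rfl | rfl | hc | hc
  · exact he
  · exact hd.ne
  · simpa only [hc, ne_eq, neg_inj] using he
  · simp only [hc]
    omega

/-- A segment of the sequence, with any earlier pin as the origin that is not adjacent to it. -/
theorem Along.segment {m : ℕ → Direction} {p : ℕ → Pin} {N : ℕ} (h : Along m p N) {o s K : ℕ}
    (ho : o < s ∨ o = 0 ∧ s = 0) (hK : s + K ≤ N) :
    Along (fun i => m (s + i)) (fun i => if i = 0 then p o else p (s + i)) K := by
  intro i hi
  obtain ⟨ha, h₁, h₂, h₃, h₄⟩ := h (s + i) (by omega)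
  simp only [Nat.add_eq_zero_iff, one_ne_zero, and_false, if_false, ← Nat.add_assoc]
  refine ⟨ha, fun j hj => ?_, fun j hj => ?_, ?_, fun h0 => ?_⟩
  · split_ifs with hj0
    · exact h₁ o (by omega)
    · exact h₁ _ (by omega)
  · split_ifs with hj0
    · exact h₂ o (by omega)
    · exact h₂ _ (by omega)
  -- In direction `m s` the pin `p (s + 1)` is beyond the pins before `p s` but, for `s > 0`, not
  -- beyond `p s`; hence the condition `o < s`.
  · rintro rfl
    rcases ho with ho | ⟨rfl, rfl⟩
    · exact h₂ o (by simpa using ho)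
    · exact h₃ rfl
  · rw [if_neg (by omega)]
    exact h₄ (by omega)

theorem Along.congr {m m' : ℕ → Direction} {p : ℕ → Pin} {N : ℕ} (h : Along m p N)
    (hm : ∀ i ≤ N, m i = m' i) : Along m' p N := by
  intro i hi
  have := h i hi
  rw [hm i (by omega), hm (i + 1) (by omega), hm 0 (by omega)] at this
  exact this

/-! ### Factors, and the words of strict and quasi-strict encodings -/

theorem letterAt_eq_getElem {v : List Direction} {i : ℕ} (hi : i < v.length) :
    letterAt v i = v[i] := by
  simp [letterAt, hi]

/-- The length bound keeps all indices in range, so the default value of `letterAt` is never read.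
-/
theorem isInfix_iff_letterAt {v W : List Direction} :
    v <:+: W ↔ ∃ s, s + v.length ≤ W.length ∧ ∀ i < v.length, letterAt v i = letterAt W (s + i) := by
  constructor
  · rintro ⟨a, b, rfl⟩
    refine ⟨a.length, by simp, fun i hi => ?_⟩
    rw [letterAt_eq_getElem hi, letterAt_eq_getElem (by simp; omega)]
    simp [hi]
  · rintro ⟨s, hs, h⟩
    have : v = (W.drop s).take v.length := by
      apply List.ext_getElem
      · simp
        omega
      · intro i h₁ h₂
        have := h i h₁
        rw [letterAt_eq_getElem h₁, letterAt_eq_getElem (by omega)] at this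
        simpa using this
    rw [this]
    exact (List.take_prefix _ _).isInfix.trans (List.drop_suffix _ _).isInfix

theorem phi_mem_phiValues {q : Numeral} {ds : List Direction} (h : ds ≠ []) :
    phi (.num q :: ds.map .dir) ∈ phiValues (.num q :: ds.map .dir) := by
  cases ds with
  | nil => exact absurd rfl h
  | cons d ds => rfl

theorem mem_phiValues_iff {q : Numeral} {ds : List Direction} (h : ds ≠ []) {y : List Direction} :
    y ∈ phiValues (.num q :: ds.map .dir) ↔ y = phi (.num q :: ds.map .dir) := by
  cases ds with
  | nil => exact absurd rfl h
  | cons d ds => rfl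

theorem Encodes.exists_along_of_isStrict {n : ℕ} {w : List Letter} {σ : Equiv.Perm (Fin n)}
    (hw : IsStrict w) (h : Encodes w σ) : (phi w).length = n + 1 ∧
      ∃ p : ℕ → Pin, Represents (fun i : Fin n => p (i + 1)) σ ∧ Along (letterAt (phi w)) p n := by
  obtain ⟨hl, p, hr, he⟩ := h.exists_nat
  obtain ⟨hlen, q, ds, rfl⟩ := hw
  have hds : ds ≠ [] := by
    rintro rfl
    simp at hlen
  have hy := phi_mem_phiValues (q := q) hds
  simp only [List.length_cons, List.length_map] at hl
  refine ⟨?_, p, hr, ?_⟩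
  · obtain ⟨e, d, hy', -⟩ := exists_of_mem_phiValues hy
    rw [hy']
    simp [hl]
  · rw [← hl]
    refine along_of_encodedAt ?_ (fun i hi => ?_) hy
    · simpa [EncodedAt] using he 0 (by simp)
    · have := he (i + 1) (by simpa using hi)
      simp only [List.getElem_cons_succ, List.getElem_map, EncodedAt] at this
      exact this.2

theorem SeparatesFrom.mono {p : Pin} {P P' Q Q' : Set Pin} {d : Direction}
    (h : SeparatesFrom p P Q d) (hP : P' ⊆ P) (hQ : Q' ⊆ Q) : SeparatesFrom p P' Q' d := by
  rw [separatesFrom_iff] at h ⊢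
  obtain ⟨h₁, e, he, h₂, h₃⟩ := h
  exact ⟨fun a ha => h₁ a (Set.union_subset_union hP hQ ha), e, he, fun a ha => h₂ a (hP ha),
    fun a ha => h₃ a (hQ ha)⟩

theorem InQuadrant.mono {p : Pin} {S S' : Set Pin} {q : Numeral} (h : InQuadrant p S q)
    (hS : S' ⊆ S) : InQuadrant p S' q := by
  have hB : ∀ {d}, Beyond p S d → Beyond p S' d := fun h =>
    beyond_iff.2 fun a ha => beyond_iff.1 h a (hS ha)
  cases q
  exacts [⟨hB h.1, hB h.2⟩, ⟨hB h.1, hB h.2⟩, ⟨hB h.1, hB h.2⟩, ⟨hB h.1, hB h.2⟩]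

/-- The origin is dropped and the first pin takes its place: the conditions on the later pins only
weaken when earlier pins are removed. Thus `p 0` is here a point of `π`. -/
theorem Encodes.exists_along_of_isQuasiStrict {k : ℕ} {u : List Letter} {π : Equiv.Perm (Fin k)}
    (hu : IsQuasiStrict u) (h : Encodes u π) {y : List Direction} (hy : y ∈ phiValues u.tail) :
    y.length = k ∧ 2 ≤ k ∧
      ∃ p : ℕ → Pin, Represents (fun i : Fin k => p i) π ∧ Along (letterAt y) p (k - 1) := by
  obtain ⟨hl, p, hr, he⟩ := h.exists_nat
  obtain ⟨q, r, ds, rfl⟩ := hu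
  simp only [List.length_cons, List.length_map] at hl
  refine ⟨?_, by omega, fun i => p (i + 1), hr, ?_⟩
  · obtain ⟨e, d, hy', -⟩ := exists_of_mem_phiValues hy
    rw [hy']
    simp [hl]
  · rw [show k - 1 = ds.length + 1 by omega]
    refine along_of_encodedAt ?_ (fun i hi => ?_) hy
    · have : InQuadrant (p 2) (p '' Set.Iio 2) r := he 1 (by simp)
      refine this.mono ?_
      rintro _ rfl
      exact ⟨1, by simp, rfl⟩
    · have := he (i + 2) (by simpa using hi)
      simp only [List.getElem_cons_succ, List.getElem_map, EncodedAt] at this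
      refine this.2.mono subset_rfl ?_
      rintro _ ⟨j, hj, rfl⟩
      exact ⟨j + 1, by simpa using hj, rfl⟩

/-! ### Patterns as subsequences of pins; simplicity -/

theorem isPattern_of_represents {k n : ℕ} {π : Equiv.Perm (Fin k)} {σ : Equiv.Perm (Fin n)}
    {r : Fin k → Pin} {q : Fin n → Pin} (hr : Represents r π) (hq : Represents q σ)
    (g : Fin k → Fin n)
    (hg : ∀ i j (c : Direction), c.key (r i) < c.key (r j) ↔ c.key (q (g i)) < c.key (q (g j))) :
    IsPattern π σ := by
  obtain ⟨τ, hτ⟩ := hr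
  obtain ⟨ρ, hρ⟩ := hq
  refine ⟨fun x => ρ (g (τ.symm x)), fun x y hxy => ?_, fun x y => ?_⟩
  · rw [← (hρ _ _).1]
    refine (hg _ _ .R).1 ((hτ _ _).1.2 ?_)
    simpa using hxy
  · have h₁ := (hτ (τ.symm x) (τ.symm y)).2
    rw [τ.apply_symm_apply, τ.apply_symm_apply] at h₁
    exact h₁.symm.trans ((hg _ _ .U).trans (hρ _ _).2)

/-- An occurrence is a set of pins; enumerating it in pin order instead of from left to right makes
`g` increasing. -/
theorem IsPattern.exists_represents {k n : ℕ} {π : Equiv.Perm (Fin k)} {σ : Equiv.Perm (Fin n)}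
    (h : IsPattern π σ) {q : Fin n → Pin} (hq : Represents q σ) :
    ∃ g : Fin k → Fin n, StrictMono g ∧ Represents (fun i => q (g i)) π := by
  obtain ⟨f, hf, hfπ⟩ := h
  obtain ⟨τ, hτ⟩ := hq
  have hinj : Function.Injective fun x => τ.symm (f x) := τ.symm.injective.comp hf.injective
  let S : Finset (Fin n) := Finset.univ.image fun x => τ.symm (f x)
  have hS : S.card = k := by
    rw [Finset.card_image_of_injective _ hinj, Finset.card_fin]
  let g := S.orderEmbOfFin hS
  have hgS : ∀ i, ∃ x, f x = τ (g i) := by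
    intro i
    obtain ⟨x, -, hx⟩ := Finset.mem_image.1 (S.orderEmbOfFin_mem hS i)
    exact ⟨x, (τ.symm_apply_eq.1 hx)⟩
  choose t ht using hgS
  have htinj : Function.Injective t := by
    intro i j hij
    apply g.injective
    apply τ.injective
    rw [← ht, ← ht, hij]
  refine ⟨g, g.strictMono, Equiv.ofBijective t (Finite.injective_iff_bijective.1 htinj),
    fun i j => ⟨?_, ?_⟩⟩
  · rw [(hτ _ _).1, ← ht, ← ht, hf.lt_iff_lt]
    rfl
  · rw [(hτ _ _).2, ← ht, ← ht, ← hfπ]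
    rfl

theorem exists_eq_Icc {k : ℕ} {S : Set (Fin k)} (hS : S.OrdConnected) (hne : S.Nonempty) :
    ∃ a b, a ≤ b ∧ S = Set.Icc a b := by
  obtain ⟨a, ha, ha'⟩ := Set.exists_min_image S id S.toFinite hne
  obtain ⟨b, hb, hb'⟩ := Set.exists_max_image S id S.toFinite hne
  exact ⟨a, b, ha' b hb, Set.Subset.antisymm (fun x hx => ⟨ha' x hx, hb' x hx⟩) (hS.out ha hb)⟩

/-- If all later pins lie beyond the pins up to the `i`-th one in two perpendicular directions,
then these form an interval. -/
theorem IsSimple.eq_zero_of_forall_beyond {k : ℕ} {π : Equiv.Perm (Fin k)} (hπ : IsSimple π)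
    {r : Fin k → Pin} (hr : Represents r π) {i : ℕ} (hi : i + 1 < k)
    (h : ∀ l : Fin k, i < l → ∃ e d, Alternates e d ∧ ∀ j : Fin k, (j : ℕ) ≤ i →
      e.key (r j) < e.key (r l) ∧ d.key (r j) < d.key (r l)) : i = 0 := by
  obtain ⟨τ, hτ⟩ := hr
  -- No later pin has a coordinate between those of two early pins, so the early pins fill an
  -- interval of columns and one of rows.
  have hside : ∀ (c : Direction) (l j j' : Fin k), i < l → (j : ℕ) ≤ i → (j' : ℕ) ≤ i →
      c.key (r j) < c.key (r l) → ¬ c.key (r l) < c.key (r j') := by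
    intro c l j j' hl hj hj' h₁ h₂
    obtain ⟨e, d, hed, hb⟩ := h l hl
    have := hb j hj
    have := hb j' hj'
    rcases hed.key_cases c with rfl | rfl | hc | hc
    · omega
    · omega
    · rw [hc, hc] at *
      omega
    · rw [hc, hc] at *
      omega
  let A : Set (Fin k) := {j | (j : ℕ) ≤ i}
  have h0 : (⟨0, by omega⟩ : Fin k) ∈ A := Nat.zero_le i
  have hX : (τ '' A).OrdConnected := by
    refine ⟨?_⟩
    rintro _ ⟨j, hj, rfl⟩ _ ⟨j', hj', rfl⟩ z ⟨hz, hz'⟩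
    obtain ⟨l, rfl⟩ := τ.surjective z
    by_contra hl
    have hl' : l ∉ A := fun hl' => hl ⟨l, hl', rfl⟩
    have hne : ∀ t ∈ A, τ t ≠ τ l := fun t ht h => hl' (τ.injective h ▸ ht)
    exact hside .R l j j' (not_le.1 hl') hj hj' ((hτ _ _).1.2 (hz.lt_of_ne (hne _ hj)))
      ((hτ _ _).1.2 (hz'.lt_of_ne (hne _ hj').symm))
  have hY : (π '' (τ '' A)).OrdConnected := by
    refine ⟨?_⟩
    rintro _ ⟨_, ⟨j, hj, rfl⟩, rfl⟩ _ ⟨_, ⟨j', hj', rfl⟩, rfl⟩ z ⟨hz, hz'⟩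
    obtain ⟨z, rfl⟩ := π.surjective z
    obtain ⟨l, rfl⟩ := τ.surjective z
    by_contra hl
    have hl' : l ∉ A := fun hl' => hl ⟨_, ⟨l, hl', rfl⟩, rfl⟩
    have hne : ∀ t ∈ A, π (τ t) ≠ π (τ l) := fun t ht h =>
      hl' (τ.injective (π.injective h) ▸ ht)
    exact hside .U l j j' (not_le.1 hl') hj hj' ((hτ _ _).2.2 (hz.lt_of_ne (hne _ hj)))
      ((hτ _ _).2.2 (hz'.lt_of_ne (hne _ hj').symm))
  obtain ⟨a, b, hab, hA⟩ := exists_eq_Icc hX ⟨_, _, h0, rfl⟩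
  obtain ⟨c, d, -, hB⟩ := exists_eq_Icc hY ⟨_, _, ⟨_, h0, rfl⟩, rfl⟩
  rw [hA] at hB
  rcases hπ a b c d hab hB with rfl | huniv
  · rw [Set.Icc_self] at hA
    have hmem : ∀ t ∈ A, τ t = a := fun t ht => by
      have := Set.mem_image_of_mem τ ht
      rwa [hA] at this
    have := τ.injective ((hmem ⟨i, by omega⟩ (le_refl i)).trans (hmem _ h0).symm)
    simpa using this
  · have hl : τ ⟨i + 1, hi⟩ ∈ τ '' A := by
      rw [hA, huniv]
      trivial
    obtain ⟨t, ht, htl⟩ := hl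
    rw [τ.injective htl] at ht
    exact absurd (show i + 1 ≤ i from ht) (by omega)

/-! ### Reading a pin word off a subsequence of pins -/

/-- When `p t` is skipped, or only the origin was chosen before, nothing chosen obstructs `p (t +
1)` in direction `m t`, so it falls into a corner. -/
theorem Along.encodedAt_num {m : ℕ → Direction} {p : ℕ → Pin} {N : ℕ} (h : Along m p N)
    {f : ℕ → ℕ} (hf : StrictMono f) {i t : ℕ} (ht : f (i + 1) = t + 1) (htN : t < N)
    (hgap : f i < t ∨ i = 0 ∧ f 0 = 0) :
    EncodedAt (fun i => p (f i)) i (.num (quadrant (m t) (m (t + 1)))) := by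
  obtain ⟨ha, h₁, h₂, h₃, h₄⟩ := h t htN
  simp only [EncodedAt, inQuadrant_quadrant_iff ha, Set.forall_mem_image, Set.mem_Iio, ht]
  refine ⟨fun j hj => ?_, fun j hj => h₁ _ ?_⟩
  · have := hf.monotone (Nat.le_of_lt_succ hj)
    rcases hgap with hgap | ⟨rfl, hf0⟩
    · exact h₂ _ (by omega)
    · rcases Nat.eq_zero_or_pos t with rfl | h0
      · rw [show f j = 0 by omega]
        exact h₃ rfl
      · exact h₂ _ (by omega)
  · have := hf hj
    omega

theorem Along.encodedAt_dir {m : ℕ → Direction} {p : ℕ → Pin} {N : ℕ} (h : Along m p N)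
    {f : ℕ → ℕ} (hf : StrictMono f) {i t : ℕ} (ht : f (i + 1) = t + 1) (htN : t < N)
    (hi : f i = t) (hi0 : 0 < i) : EncodedAt (fun i => p (f i)) i (.dir (m (t + 1))) := by
  obtain ⟨ha, h₁, h₂, h₃, h₄⟩ := h t htN
  have := hf hi0
  refine ⟨hi0, separatesFrom_iff.2 ⟨?_, m t, ha, ?_, ?_⟩⟩
  · simp only [ht, hi]
    rintro _ (rfl | ⟨j, hj, rfl⟩)
    · exact h₁ _ le_rfl
    · have := hf (show j < i from hj)
      exact h₁ _ (by omega)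
  · simp only [ht, hi]
    rintro _ rfl
    exact h₄ (by omega)
  · simp only [ht]
    rintro _ ⟨j, hj, rfl⟩
    have := hf (show j < i from hj)
    exact h₂ _ (by omega)

theorem Along.coordinates_ne {m : ℕ → Direction} {p : ℕ → Pin} {N : ℕ} (h : Along m p N)
    {i j : ℕ} (hij : i < j) (hj : j ≤ N) : (p i).1 ≠ (p j).1 ∧ (p i).2 ≠ (p j).2 :=
  ⟨h.key_ne hij hj .R, h.key_ne hij hj .U⟩

/-! ### Counting the words of `E π` -/

/-- From the third pin on, the pins `r 0, …, r (k - 1)` are placed along the word `D`. -/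
def AlongFromThird (D : ℕ → Direction) (r : ℕ → Pin) (k : ℕ) : Prop :=
  ∀ i, i + 2 < k → Alternates (D (i + 1)) (D (i + 2)) ∧
    (∀ j < i + 2, (D (i + 2)).key (r j) < (D (i + 2)).key (r (i + 2))) ∧
    ∀ j < i + 1, (D (i + 1)).key (r j) < (D (i + 1)).key (r (i + 2))

theorem Along.fromThird {m : ℕ → Direction} {p : ℕ → Pin} {k : ℕ} (h : Along m p (k - 1)) :
    AlongFromThird m p k := by
  intro i hi
  obtain ⟨ha, h₁, h₂, -⟩ := h (i + 1) (by omega)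
  exact ⟨ha, fun j hj => h₁ j (by omega), h₂⟩

theorem Along.tail_fromThird {m : ℕ → Direction} {p : ℕ → Pin} {k : ℕ} (h : Along m p k) :
    AlongFromThird (fun i => m (i + 1)) (fun i => p (i + 1)) k := by
  intro i hi
  obtain ⟨ha, h₁, h₂, -⟩ := h (i + 2) (by omega)
  exact ⟨ha, fun j hj => h₁ _ (by omega), fun j hj => h₂ _ (by omega)⟩

theorem Represents.exists_perm {k : ℕ} {π : Equiv.Perm (Fin k)} {r r' : ℕ → Pin}
    (hr : Represents (fun i : Fin k => r i) π) (hr' : Represents (fun i : Fin k => r' i) π) :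
    ∃ ρ : Equiv.Perm (Fin k), ∀ (c : Direction) (i j : Fin k),
      c.key (r' i) < c.key (r' j) ↔ c.key (r (ρ i)) < c.key (r (ρ j)) := by
  obtain ⟨τ, hτ⟩ := hr
  obtain ⟨τ', hτ'⟩ := hr'
  refine ⟨τ'.trans τ.symm, fun c i j => ?_⟩
  have h : ∀ i j : Fin k, ((r' i).1 < (r' j).1 ↔
      (r ((τ'.trans τ.symm) i)).1 < (r ((τ'.trans τ.symm) j)).1) ∧ ((r' i).2 < (r' j).2 ↔
      (r ((τ'.trans τ.symm) i)).2 < (r ((τ'.trans τ.symm) j)).2) := by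
    intro i j
    rw [(hτ' i j).1, (hτ' i j).2, (hτ _ _).1, (hτ _ _).2]
    simp
  cases c
  · simpa only [Direction.key, neg_lt_neg_iff] using (h j i).1
  · exact (h i j).1
  · exact (h i j).2
  · simpa only [Direction.key, neg_lt_neg_iff] using (h j i).2

/-- Of a sequence of pins representing `π`, the last direction determines all other ones from the
third on. -/
theorem AlongFromThird.eq_of_last_eq {k : ℕ} {π : Equiv.Perm (Fin k)} {D D' : ℕ → Direction}
    {r r' : ℕ → Pin} (hr : Represents (fun i : Fin k => r i) π)
    (hr' : Represents (fun i : Fin k => r' i) π) (h : AlongFromThird D r k)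
    (h' : AlongFromThird D' r' k) (hlast : D (k - 1) = D' (k - 1)) {i : ℕ} (hi : 2 ≤ i)
    (hik : i < k) : D i = D' i := by
  obtain ⟨ρ, hρ⟩ := hr.exists_perm hr'
  -- Descending induction: the relabelling `ρ` between the two representations fixes all pins
  -- already peeled off.
  suffices ∀ i, 2 ≤ i → i ≤ k - 1 → D i = D' i ∧ ∀ j : Fin k, i < j → ρ j = j from
    (this i hi (by omega)).1
  clear hi hik i
  intro i hi hik
  induction hik using Nat.decreasingInduction with
  | self => exact ⟨hlast, fun j hj => absurd j.2 (by omega)⟩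
  | of_succ i hik ih =>
    obtain ⟨hD, hfix⟩ := ih (by omega)
    obtain ⟨i, rfl⟩ : ∃ t, i = t + 2 := ⟨i - 2, by omega⟩
    obtain ⟨ha, h₁, h₂⟩ := h (i + 1) (by omega)
    obtain ⟨ha', h₁', h₂'⟩ := h' (i + 1) (by omega)
    rw [show i + 1 + 2 = i + 3 from rfl] at *
    have hlt : ∀ l : Fin k, (l : ℕ) ≤ i + 3 → (ρ l : ℕ) ≤ i + 3 := by
      intro l hl
      by_contra! hlt
      have := congrArg Fin.val (ρ.injective (hfix _ hlt))
      omega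
    have hi3 : i + 3 < k := by omega
    -- Among the remaining pins, pin `i + 3` is the unique extreme one in the common direction `D (i
    -- + 3)`.
    have hfix3 : ρ ⟨i + 3, hi3⟩ = ⟨i + 3, hi3⟩ := by
      by_contra hne
      have hl : (ρ ⟨i + 3, hi3⟩ : ℕ) < i + 3 :=
        lt_of_le_of_ne (hlt _ le_rfl) fun h => hne (Fin.ext h)
      obtain ⟨l', hl'⟩ := ρ.surjective ⟨i + 3, hi3⟩
      have hl'3 : (l' : ℕ) < i + 3 := by
        rcases lt_trichotomy (l' : ℕ) (i + 3) with hlt' | heq | hgt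
        · exact hlt'
        · exact absurd ((Fin.ext heq : l' = ⟨i + 3, hi3⟩) ▸ hl') hne
        · have := congrArg Fin.val ((hfix _ hgt).symm.trans hl')
          simp only at this
          omega
      have hkey := h₁' _ hl'3
      rw [← hD] at hkey
      have hkey := (hρ _ l' ⟨i + 3, hi3⟩).1 hkey
      rw [hl'] at hkey
      exact absurd (h₁ _ hl) hkey.asymm
    refine ⟨?_, fun j hj => ?_⟩
    · rw [← hD] at ha'
      rcases ha.eq_or_key_neg ha' with heq | hneg
      · exact heq.symm
      -- In direction `D (i + 2)` only pin `i + 2` can exceed pin `i + 3` among the remaining ones.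
      -- With `D' (i + 2)` opposite, all of the at least two pins before `i + 2` would have to be
      -- sent to it.
      · have hprev : ∀ l : Fin k, (l : ℕ) < i + 2 → (ρ l : ℕ) = i + 2 := by
          intro l hl
          have hkey := h₂' l hl
          rw [show i + 1 + 1 = i + 2 from rfl, hneg, hneg, neg_lt_neg_iff] at hkey
          have hkey := (hρ _ ⟨i + 3, hi3⟩ l).1 hkey
          rw [hfix3] at hkey
          by_contra hne
          have hle := hlt l (by omega)
          have hne3 : (ρ l : ℕ) ≠ i + 3 := by
            intro h
            have := congrArg Fin.val (ρ.injective ((Fin.ext h : ρ l = ⟨i + 3, hi3⟩).trans hfix3.symm))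
            simp only at this
            omega
          exact absurd (h₂ (ρ l) (by omega)) hkey.asymm
        have h01 := ρ.injective (Fin.ext ((hprev ⟨0, by omega⟩ (by simp)).trans
          (hprev ⟨1, by omega⟩ (by simp)).symm))
        simp at h01
    · rcases Nat.lt_or_ge (i + 3) j with hlt' | hge
      · exact hfix j hlt'
      · obtain rfl : j = ⟨i + 3, hi3⟩ := Fin.ext (by simp only; omega)
        exact hfix3

theorem ext_letterAt {v v' : List Direction} (hl : v.length = v'.length)
    (h : ∀ i < v.length, letterAt v i = letterAt v' i) : v = v' := by
  refine List.ext_getElem hl fun i h₁ h₂ => ?_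
  rw [← letterAt_eq_getElem h₁, ← letterAt_eq_getElem h₂, h i h₁]

theorem letterAt_alternates {v : List Direction} (hv : v ∈ M) {i : ℕ} (hi : i + 1 < v.length) :
    Alternates (letterAt v i) (letterAt v (i + 1)) := by
  rw [letterAt_eq_getElem (by omega), letterAt_eq_getElem hi]
  exact List.isChain_iff_getElem.1 hv.2 i hi

theorem finite_and_ncard_le_of_injOn {α β : Type*} {s : Set α} {t : Finset β} {f : α → β}
    (hf : Set.MapsTo f s t) (hinj : Set.InjOn f s) : s.Finite ∧ s.ncard ≤ t.card := by
  refine ⟨Set.Finite.of_injOn hf hinj t.finite_toSet, ?_⟩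
  rw [← Set.ncard_coe_finset]
  exact Set.ncard_le_ncard_of_injOn f hf hinj t.finite_toSet

/-- A word is determined by its first three letters, which alternate, and its last: 4 · 2 · 2 · 4 =
64. -/
theorem phi_strict_finite {k : ℕ} (hk : 2 ≤ k) (π : Equiv.Perm (Fin k)) :
    {v | ∃ u, IsStrict u ∧ Encodes u π ∧ v = phi u}.Finite ∧
      {v | ∃ u, IsStrict u ∧ Encodes u π ∧ v = phi u}.ncard ≤ 64 := by
  let t : Finset (Direction × Direction × Direction × Direction) :=
    Finset.univ.filter fun x => Alternates x.1 x.2.1 ∧ Alternates x.2.1 x.2.2.1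
  have ht : t.card = 64 := by decide +kernel
  rw [← ht]
  refine finite_and_ncard_le_of_injOn
    (f := fun v => (letterAt v 0, letterAt v 1, letterAt v 2, letterAt v k)) ?_ ?_
  · rintro _ ⟨u, hu, hπ, rfl⟩
    obtain ⟨-, p, -, hp⟩ := hπ.exists_along_of_isStrict hu
    simp only [t, Finset.coe_filter, Finset.mem_univ, true_and, Set.mem_ofPred_eq]
    exact ⟨(hp 0 (by omega)).1, (hp 1 (by omega)).1⟩
  · rintro _ ⟨u, hu, hπ, rfl⟩ _ ⟨u', hu', hπ', rfl⟩ heq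
    obtain ⟨hl, p, hr, hp⟩ := hπ.exists_along_of_isStrict hu
    obtain ⟨hl', p', hr', hp'⟩ := hπ'.exists_along_of_isStrict hu'
    simp only [Prod.mk.injEq] at heq
    obtain ⟨h0, h1, h2, hlast⟩ := heq
    refine ext_letterAt (hl.trans hl'.symm) fun i hi => ?_
    match i with
    | 0 => exact h0
    | 1 => exact h1
    | 2 => exact h2
    | i + 3 =>
      refine AlongFromThird.eq_of_last_eq (i := i + 2) hr hr' hp.tail_fromThird
        hp'.tail_fromThird ?_ (by omega) (by omega)
      simpa only [show k - 1 + 1 = k by omega] using hlast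

/-- Now four alternating initial letters are free, besides the last: 4 · 2 · 2 · 2 · 4 = 128.
Membership in `M` gives the alternation between `x₂` and `y`. -/
theorem phi_quasiStrict_finite {k : ℕ} (π : Equiv.Perm (Fin k)) :
    {v | v ∈ M ∧ ∃ u, IsQuasiStrict u ∧ Encodes u π ∧
      ∃ x₁ x₂ : Direction, Alternates x₁ x₂ ∧ ∃ y ∈ phiValues u.tail, v = x₁ :: x₂ :: y}.Finite ∧
    {v | v ∈ M ∧ ∃ u, IsQuasiStrict u ∧ Encodes u π ∧
      ∃ x₁ x₂ : Direction, Alternates x₁ x₂ ∧ ∃ y ∈ phiValues u.tail, v = x₁ :: x₂ :: y}.ncard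
      ≤ 128 := by
  let t : Finset (Direction × Direction × Direction × Direction × Direction) :=
    Finset.univ.filter fun x => Alternates x.1 x.2.1 ∧ Alternates x.2.1 x.2.2.1 ∧
      Alternates x.2.2.1 x.2.2.2.1
  have ht : t.card = 128 := by decide +kernel
  rw [← ht]
  refine finite_and_ncard_le_of_injOn (f := fun v =>
    (letterAt v 0, letterAt v 1, letterAt v 2, letterAt v 3, letterAt v (k + 1))) ?_ ?_
  · rintro _ ⟨hM, u, hu, hπ, x₁, x₂, hx, y, hy, rfl⟩
    obtain ⟨hl, hk, -⟩ := hπ.exists_along_of_isQuasiStrict hu hy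
    simp only [t, Finset.coe_filter, Finset.mem_univ, true_and, Set.mem_ofPred_eq]
    exact ⟨hx, letterAt_alternates hM (by simp; omega), letterAt_alternates hM (by simp; omega)⟩
  · rintro _ ⟨-, u, hu, hπ, x₁, x₂, -, y, hy, rfl⟩ _ ⟨-, u', hu', hπ', x₁', x₂', -, y', hy', rfl⟩ heq
    obtain ⟨hl, hk, p, hr, hp⟩ := hπ.exists_along_of_isQuasiStrict hu hy
    obtain ⟨hl', -, p', hr', hp'⟩ := hπ'.exists_along_of_isQuasiStrict hu' hy'
    simp only [Prod.mk.injEq] at heq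
    obtain ⟨h0, h1, h2, h3, hlast⟩ := heq
    refine ext_letterAt (by simp [hl, hl']) fun i hi => ?_
    match i with
    | 0 => exact h0
    | 1 => exact h1
    | 2 => exact h2
    | 3 => exact h3
    | i + 4 =>
      refine AlongFromThird.eq_of_last_eq (i := i + 2) (D := letterAt y) (D' := letterAt y') hr hr'
        hp.fromThird hp'.fromThird ?_ (by omega) (by simp at hi; omega)
      obtain ⟨k, rfl⟩ : ∃ t, k = t + 1 := ⟨k - 1, by omega⟩
      exact hlast

theorem E_finite {k : ℕ} (hk : 2 ≤ k) (π : Equiv.Perm (Fin k)) :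
    (E π).Finite ∧ (E π).ncard ≤ 256 := by
  obtain ⟨h₁, h₂⟩ := phi_strict_finite hk π
  obtain ⟨h₃, h₄⟩ := phi_quasiStrict_finite π
  refine ⟨h₁.union h₃, (Set.ncard_union_le _ _).trans ?_⟩
  omega

/-! ### Factors give patterns, and conversely -/

theorem isPattern_of_mem_E {k n : ℕ} {π : Equiv.Perm (Fin k)} {σ : Equiv.Perm (Fin n)}
    {w : List Letter} (hw : IsStrict w) (hσ : Encodes w σ) {v : List Direction} (hv : v ∈ E π)
    (h : v <:+: phi w) : IsPattern π σ := by
  obtain ⟨hlw, p, hp, hA⟩ := hσ.exists_along_of_isStrict hw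
  obtain ⟨s, hs, hvs⟩ := isInfix_iff_letterAt.1 h
  rcases hv with ⟨u, hu, hπ, rfl⟩ | ⟨-, u, hu, hπ, x₁, x₂, -, y, hy, rfl⟩
  · obtain ⟨hl, r, hr, hB⟩ := hπ.exists_along_of_isStrict hu
    have hseg := hA.segment (o := 0) (s := s) (K := k) (by omega) (by omega)
    have hB := hB.congr (m' := fun i => letterAt (phi w) (s + i)) fun i hi => hvs i (by omega)
    refine isPattern_of_represents hr hp (fun i => ⟨s + i, by omega⟩) fun i j c => ?_
    exact hB.key_lt_iff hseg (by omega) (by omega) c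
  · obtain ⟨hl, hk, r, hr, hB⟩ := hπ.exists_along_of_isQuasiStrict hu hy
    simp only [List.length_cons, hl] at hs hvs
    -- The letters `x₁ x₂` shift the block by two places, so that `p (s + 1)` is a genuine pin not
    -- adjacent to the block's first pin `p (s + 3)`.
    have hseg := hA.segment (o := s + 1) (s := s + 2) (K := k - 1) (by omega) (by omega)
    have hB := hB.congr (m' := fun i => letterAt (phi w) (s + 2 + i)) fun i hi => by
      rw [show s + 2 + i = s + (i + 2) by omega, ← hvs (i + 2) (by omega)]
      rfl
    refine isPattern_of_represents hr hp
      (fun i => if (i : ℕ) = 0 then ⟨s, by omega⟩ else ⟨s + 1 + i, by omega⟩) fun i j c => ?_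
    refine (hB.key_lt_iff hseg (by omega) (by omega) c).trans (iff_of_eq ?_)
    congr 2 <;> split_ifs <;> simp <;> congr 1 <;> omega

theorem exists_mem_E_of_isPattern {k n : ℕ} {π : Equiv.Perm (Fin k)} (hk : 2 ≤ k)
    (hπ : IsSimple π) {σ : Equiv.Perm (Fin n)} {w : List Letter} (hw : IsStrict w)
    (hσ : Encodes w σ) (h : IsPattern π σ) : ∃ v ∈ E π, v <:+: phi w := by
  obtain ⟨hlw, p, hp, hA⟩ := hσ.exists_along_of_isStrict hw
  obtain ⟨g, hg, hr⟩ := h.exists_represents hp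
  obtain ⟨k, rfl⟩ : ∃ t, k = t + 2 := ⟨k - 2, by omega⟩
  set m := letterAt (phi w) with hm
  -- At a gap, each later chosen pin is beyond the chosen pins up to the `i`-th in both of its
  -- directions, as none of these is its immediate predecessor; simplicity then forces `i = 0`.
  have hgap : ∀ i (hi : i + 1 < k + 2), 0 < i →
      (g ⟨i + 1, hi⟩ : ℕ) = g ⟨i, by omega⟩ + 1 := by
    intro i hi h0
    by_contra hne
    have hlt : (g ⟨i, by omega⟩ : ℕ) < g ⟨i + 1, hi⟩ := hg (by simp [Fin.lt_def])
    refine absurd (hπ.eq_zero_of_forall_beyond hr hi fun l hl => ?_) h0.ne'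
    obtain ⟨ha, h₁, h₂, -⟩ := hA (g l) (g l).2
    refine ⟨_, _, ha, fun j hj => ?_⟩
    have hgj : (g j : ℕ) ≤ g ⟨i, by omega⟩ := hg.monotone (Fin.le_def.2 hj)
    have hgl : (g ⟨i + 1, hi⟩ : ℕ) ≤ g l := hg.monotone (Fin.le_def.2 hl)
    exact ⟨h₂ _ (by omega), h₁ _ (by omega)⟩
  set a : ℕ := (g ⟨0, by omega⟩).val with hga
  set b : ℕ := (g ⟨1, by omega⟩).val with hgb
  have hab : a < b := hg (by simp)
  have hgi : ∀ i (hi : i + 1 < k + 2), (g ⟨i + 1, hi⟩ : ℕ) = b + i := by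
    intro i
    induction i with
    | zero => exact fun _ => rfl
    | succ i ih =>
      intro hi
      rw [hgap (i + 1) hi (by omega), ih]
      omega
  have hbn : b + k < n := hgi k (by omega) ▸ (g ⟨k + 1, by omega⟩).2
  clear_value a b
  -- Indices of the origin and of the chosen pins; the shift by one arises because `g` numbers the
  -- pins `p 1, …, p n` from zero.
  let f : ℕ → ℕ
    | 0 => 0
    | 1 => a + 1
    | i + 2 => b + i + 1
  have hf : StrictMono f := by
    refine strictMono_nat_of_lt_succ fun i => ?_
    match i with
    | 0 => simp [f]
    | 1 => simpa [f] using hab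
    | i + 2 => simp only [f]; omega
  have hfn : ∀ i ≤ k + 2, f i ≤ n := by
    intro i hi
    match i with
    | 0 => simp [f]
    | 1 => simp only [f]; omega
    | i + 2 => simp only [f]; omega
  have hrf : Represents (fun i : Fin (k + 2) => p (f (i + 1))) π := by
    convert hr using 3 with i
    obtain ⟨i, hi⟩ := i
    cases i with
    | zero => exact congrArg (· + 1) hga
    | succ i => rw [hgi i hi]
  have hd : ∀ i j, i < j → j ≤ k + 2 →
      (p (f i)).1 ≠ (p (f j)).1 ∧ (p (f i)).2 ≠ (p (f j)).2 := fun i j hij hj =>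
    hA.coordinates_ne (hf hij) (hfn j hj)
  have hnum₀ := hA.encodedAt_num hf (i := 0) (t := a) rfl (by omega) (Or.inr ⟨rfl, rfl⟩)
  have hdir : ∀ i < k, EncodedAt (fun i => p (f i)) (i + 2) (.dir (m (b + i + 2))) := fun i hi =>
    hA.encodedAt_dir hf (i := i + 2) (t := b + i + 1) rfl (by omega) rfl (by omega)
  let ds : List Direction := List.ofFn fun i : Fin k => m (b + i + 2)
  have hds : ∀ i < k, letterAt ds i = m (b + i + 2) := by
    intro i hi
    rw [letterAt_eq_getElem (by simpa [ds] using hi)]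
    simp [ds]
  have hhead : ∀ c ∈ ds.head?, Alternates (m (b + 1)) c := by
    intro c hc
    rcases Nat.eq_zero_or_pos k with rfl | h0
    · simp [ds] at hc
    · have : c = m (b + 2) := by
        rw [List.head?_eq_getElem?, List.getElem?_eq_getElem (by simpa [ds] using h0)] at hc
        simpa [ds, eq_comm] using hc
      rw [this]
      exact (hA (b + 1) (by omega)).1
  by_cases hadj : b = a + 1
  · have hdir₁ : EncodedAt (fun i => p (f i)) 1 (.dir (m (b + 1))) :=
      hA.encodedAt_dir hf (i := 1) (t := b) rfl (by omega) hadj.symm (by omega)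
    refine ⟨m a :: m (a + 1) :: m (b + 1) :: ds, Or.inl
      ⟨.num (quadrant (m a) (m (a + 1))) :: (m (b + 1) :: ds).map .dir, ⟨by simp, _, _, rfl⟩,
        ?_, ?_⟩, isInfix_iff_letterAt.2 ⟨a, by simp [ds]; omega, fun i hi => ?_⟩⟩
    · have := encodes_of_encodedAt (p := fun i => p (f i))
        (Fin.cons (.num (quadrant (m a) (m (a + 1)))) (Fin.cons (.dir (m (b + 1)))
          fun i : Fin k => .dir (m (b + i + 2)))) hrf hd ?_
      · simpa [ds, List.map_ofFn, List.ofFn_succ, Function.comp_def] using this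
      · refine Fin.cases hnum₀ (Fin.cases hdir₁ fun i => ?_)
        exact hdir i i.2
    · refine (mem_phiValues_iff (by simp)).1 (mem_phiValues (hA a (by omega)).1 ?_)
      intro c hc
      obtain rfl : m (b + 1) = c := by simpa using hc
      rw [hadj]
      exact (hA (a + 1) (by omega)).1
    · match i with
      | 0 => rfl
      | 1 => rfl
      | 2 => exact congrArg m (show b + 1 = a + 2 by omega)
      | i + 3 =>
        refine (hds i (by simpa [ds] using hi)).trans (congrArg m ?_)
        omega
  · have hnum₁ := hA.encodedAt_num hf (i := 1) (t := b) rfl (by omega)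
      (Or.inl (show a + 1 < b by omega))
    -- Non-adjacency gives `b ≥ a + 2`, so two letters precede the block's word in `m`; they serve
    -- as `x`.
    obtain ⟨c, rfl⟩ : ∃ c, b = c + 2 := ⟨b - 2, by omega⟩
    have hinf : ∀ i < k + 4, letterAt (m c :: m (c + 1) :: m (c + 2) :: m (c + 3) :: ds) i =
        m (c + i) := by
      intro i hi
      match i with
      | 0 => rfl
      | 1 => rfl
      | 2 => rfl
      | 3 => rfl
      | i + 4 =>
        refine (hds i (by omega)).trans (congrArg m ?_)
        omega
    have hlen : (m c :: m (c + 1) :: m (c + 2) :: m (c + 3) :: ds).length = k + 4 := by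
      simp [ds]
    refine ⟨m c :: m (c + 1) :: m (c + 2) :: m (c + 3) :: ds, Or.inr ⟨⟨by simp, ?_⟩,
      .num (quadrant (m a) (m (a + 1))) :: .num (quadrant (m (c + 2)) (m (c + 3))) :: ds.map .dir,
      ⟨_, _, _, rfl⟩, ?_, m c, m (c + 1), (hA c (by omega)).1, _,
      mem_phiValues (hA (c + 2) (by omega)).1 hhead, rfl⟩,
      isInfix_iff_letterAt.2 ⟨c, by omega, fun i hi => hinf i (by omega)⟩⟩
    · rw [List.isChain_iff_getElem]
      intro i hi
      rw [← letterAt_eq_getElem hi, ← letterAt_eq_getElem (by omega), hinf i (by omega),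
        hinf (i + 1) (by omega)]
      exact (hA (c + i) (by omega)).1
    · have := encodes_of_encodedAt (p := fun i => p (f i))
        (Fin.cons (.num (quadrant (m a) (m (a + 1))))
          (Fin.cons (.num (quadrant (m (c + 2)) (m (c + 3))))
            fun i : Fin k => .dir (m (c + 2 + i + 2)))) hrf hd ?_
      · simpa [ds, List.map_ofFn, List.ofFn_succ, Function.comp_def] using this
      · refine Fin.cases hnum₀ (Fin.cases hnum₁ fun i => ?_)
        exact hdir i i.2

end PinPerm

theorem theorem1 {k n : ℕ} (π : Equiv.Perm (Fin k)) (hk : 2 ≤ k) (hπ : PinPerm.IsSimple π)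
    (σ : Equiv.Perm (Fin n)) (w : List PinPerm.Letter)
    (hw : PinPerm.IsStrict w) (hwσ : PinPerm.Encodes w σ) :
    ((PinPerm.E π).Finite ∧ (PinPerm.E π).ncard ≤ 256) ∧
    (¬ PinPerm.IsPattern π σ ↔ ∀ v ∈ PinPerm.E π, ¬ v <:+: PinPerm.phi w) := by
  refine ⟨PinPerm.E_finite hk π, fun h v hv hvw => h ?_, fun h hpat => ?_⟩
  · exact PinPerm.isPattern_of_mem_E hw hwσ hv hvw
  · obtain ⟨v, hv, hvw⟩ := PinPerm.exists_mem_E_of_isPattern hk hπ hw hwσ hpat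
    exact h v hv hvw
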